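/- For integers $0\le M<N$ let $\mathbf A(M,N)$ be the space of real symmetric idempotent $N\times N$ matrices of rank $M$, and let $\mu$ be the $\mathbf O(N)$-invariant probability measure on it, induced by the normalised Haar measure of the orthogonal group $\mathbf O(N)$ through $O\mapsto O\,I_{M,N}\,O^{T}$, where $I_{M,N}=\mathrm{diag}(1,\dots,1,0,\dots,0)$ has $M$ ones. Let $\mathcal P_k$ be the set of pair partitions of $\{1,\dots,2k\}$ (partitions into two-element sets; $\mathcal P_0$ contains only the empty one), on which the symmetric group $S_{2k}$ acts by $\{a,b\}\in\mathfrak m\Leftrightarrow\{\sigma(a),\sigma(b)\}\in\sigma\cdot\mathfrak m$. A function $f:\{1,\dots,2k\}\to\{1,\dots,N\}$ is strongly admissible for $\mathfrak m\in\mathcal P_k$ if, for all $a\neq b$, $f(a)=f(b)$ if and only if $\{a,b\}\in\mathfrak m$. **Theorem (Weingarten function $\mathrm{Wg}^{\mathbf A}$ and its orthogonality relations).** (a) For each $k\ge 0$ and each $\mathfrak m\in\mathcal P_k$ there is a unique rational function $\mathrm{Wg}^{\mathbf A}(\mathfrak m)\in\mathbb R(M,N)$ that, for all integers $0\le M<N$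 with $k\le N$, is regular at $(M,N)$ and takes there the value $$\int_{\mathbf A(M,N)}A_{f(1)f(2)}A_{f(3)f(4)}\cdots A_{f(2k-1)f(2k)}\,\mathrm d\mu$$ for every $f$ that is strongly admissible for $\mathfrak m$. (b) For each $k\ge 1$ and each $\mathfrak m\in\mathcal P_k$, in $\mathbb R(M,N)$, $$\mathrm{Wg}^{\mathbf A}(\mathfrak m)=-\frac1N\sum_{i=1}^{2k-2}\mathrm{Wg}^{\mathbf A}\big((i\;\,2k-1)\cdot\mathfrak m\big)+\frac MN\,\delta_{\{2k-1,2k\}\in\mathfrak m}\,\mathrm{Wg}^{\mathbf A}(\mathfrak m^{\downarrow})+\frac1N\sum_{i=1}^{2k-2}\delta_{\{i,2k\}\in\mathfrak m}\,\mathrm{Wg}^{\mathbf A}\big([(i\;\,2k-1)\cdot\mathfrak m]^{\downarrow}\big).$$ Here $\delta_{\{i,j\}\in\mathfrak m}$ is $1$ if $\{i,j\}\in\mathfrak m$ and $0$ otherwise (a term with $\delta=0$ is $0$), and, for a pair partition $\mathfrak n\in\mathcal P_k$ containing $\{2k-1,2k\}$, $\mathfrak n^{\downarrow}\in\mathcal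 P_{k-1}$ is obtained from $\mathfrak n$ by removing that pair. -/

import Mathlib

open MeasureTheory

noncomputable section

namespace GrassmannWeingarten

/-! ## Pair partitions -/

/-- A pair partition of the `2k`-element set `Fin (2 * k)`, the element `j : Fin (2 * k)` standing
for the number `j + 1` of `{1, …, 2k}`: a set of two-element subsets such that each element lies in
exactly one of them.  For `k = 0` there is exactly one, the empty pair partition. -/
@[ext]
structure PairPartition (k : ℕ) where
  pairs : Finset (Finset (Fin (2 * k)))
  card_eq_two : ∀ p ∈ pairs, p.card = 2
  existsUnique_mem : ∀ a, ∃! p, p ∈ pairs ∧ a ∈ p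

/-- The natural action of the symmetric group on pair partitions: the pair `{a, b}` of `m` becomes
the pair `{σ a, σ b}` of `σ • m`. -/
instance (k : ℕ) : SMul (Equiv.Perm (Fin (2 * k))) (PairPartition k) where
  smul σ m :=
    { pairs := m.pairs.image (fun p => p.map σ.toEmbedding)
      card_eq_two := by
        intro p hp
        obtain ⟨q, hq, rfl⟩ := Finset.mem_image.1 hp
        rw [Finset.card_map]
        exact m.card_eq_two q hq
      existsUnique_mem := by
        intro a
        obtain ⟨p, ⟨hp, hap⟩, hu⟩ := m.existsUnique_mem (σ.symm a)
        refine ⟨p.map σ.toEmbedding, ⟨Finset.mem_image_of_mem _ hp, ?_⟩, ?_⟩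
        · exact Finset.mem_map.2 ⟨σ.symm a, hap, by simp⟩
        · rintro q ⟨hq, haq⟩
          obtain ⟨q', hq', rfl⟩ := Finset.mem_image.1 hq
          obtain ⟨c, hc, hca⟩ := Finset.mem_map.1 haq
          have hc' : c = σ.symm a := by rw [← hca]; simp
          subst hc'
          exact congrArg _ (hu q' ⟨hq', hc⟩) }

/-- For `{a, b} ∈ m` one has `{σ a, σ b} ∈ σ • m`. -/
theorem pair_mem_smul {k : ℕ} (σ : Equiv.Perm (Fin (2 * k))) {m : PairPartition k}
    {a b : Fin (2 * k)} (h : {a, b} ∈ m.pairs) : {σ a, σ b} ∈ (σ • m).pairs := by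
  refine Finset.mem_image.2 ⟨{a, b}, h, ?_⟩
  simp

/-- The second to last element of the ground set of a pair partition in `P_{k+1}`,
standing for the number `2(k+1) - 1`. -/
def penult (k : ℕ) : Fin (2 * (k + 1)) := ⟨2 * k, by omega⟩

/-- The last element of the ground set of a pair partition in `P_{k+1}`,
standing for the number `2(k+1)`. -/
def ult (k : ℕ) : Fin (2 * (k + 1)) := ⟨2 * k + 1, by omega⟩

/-- The inclusion of `{1, …, 2k}` into `{1, …, 2(k+1)}`. -/
def incl (k : ℕ) : Fin (2 * k) ↪ Fin (2 * (k + 1)) := Fin.castLEEmb (by omega)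

/-- If `m ∈ P_{k+1}` contains the pair of the last two elements, `m.down h ∈ P_k` is the
pair partition obtained by removing that pair. -/
def PairPartition.down {k : ℕ} (m : PairPartition (k + 1)) (h : {penult k, ult k} ∈ m.pairs) :
    PairPartition k where
  pairs := Finset.univ.filter (fun p => p.map (incl k) ∈ m.pairs)
  card_eq_two := by
    intro p hp
    rw [← Finset.card_map (incl k)]
    exact m.card_eq_two _ (Finset.mem_filter.1 hp).2
  existsUnique_mem := by
    intro a
    obtain ⟨p, ⟨hp, hap⟩, hu⟩ := m.existsUnique_mem (incl k a)
    have key : ∀ c ∈ p, c ∈ Set.range (incl k) := by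
      intro c hc
      by_contra hcr
      have hc2 : c = penult k ∨ c = ult k := by
        have h1 : ¬ (c : ℕ) < 2 * k := fun hlt => hcr ⟨⟨c, hlt⟩, by ext; simp [incl]⟩
        have h2 := c.2
        rcases Nat.lt_or_ge (c : ℕ) (2 * k + 1) with h3 | h3
        · left; ext; simp only [penult]; omega
        · right; ext; simp only [ult]; omega
      have hmem : c ∈ ({penult k, ult k} : Finset (Fin (2 * (k + 1)))) := by
        simpa using hc2
      obtain ⟨q, _, hq⟩ := m.existsUnique_mem c
      have e : p = {penult k, ult k} := (hq p ⟨hp, hc⟩).trans (hq _ ⟨h, hmem⟩).symm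
      rw [e] at hap
      have ha := a.2
      simp only [Finset.mem_insert, Finset.mem_singleton, Fin.ext_iff, incl, penult, ult,
        Fin.castLEEmb_apply, Fin.val_castLE] at hap
      omega
    have hp' : (Finset.univ.filter (fun c => incl k c ∈ p)).map (incl k) = p := by
      ext c
      simp only [Finset.mem_map, Finset.mem_filter, Finset.mem_univ, true_and]
      constructor
      · rintro ⟨d, hd, rfl⟩; exact hd
      · intro hc
        obtain ⟨d, rfl⟩ := key c hc
        exact ⟨d, hc, rfl⟩
    refine ⟨Finset.univ.filter (fun c => incl k c ∈ p), ⟨?_, ?_⟩, ?_⟩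
    · simp only [Finset.mem_filter, Finset.mem_univ, true_and]
      rw [hp']; exact hp
    · simpa using hap
    · rintro q ⟨hq, haq⟩
      have hq' := (Finset.mem_filter.1 hq).2
      have : q.map (incl k) = p := hu _ ⟨hq', Finset.mem_map_of_mem _ haq⟩
      apply Finset.map_injective (incl k)
      rw [this, hp']

/-- If `{i, 2k+2} ∈ m` with `i ≤ 2k`, then `{2k+1, 2k+2} ∈ (i 2k+1) • m`. -/
theorem last_pair_mem_swap_smul {k : ℕ} {m : PairPartition (k + 1)} {i : Fin (2 * k)}
    (h : {incl k i, ult k} ∈ m.pairs) :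
    {penult k, ult k} ∈ (Equiv.swap (incl k i) (penult k) • m).pairs := by
  have h1 := pair_mem_smul (Equiv.swap (incl k i) (penult k)) h
  have hi := i.2
  rwa [Equiv.swap_apply_left, Equiv.swap_apply_of_ne_of_ne] at h1
  · simp only [ne_eq, Fin.ext_iff, incl, ult, Fin.castLEEmb_apply, Fin.val_castLE]; omega
  · simp only [ne_eq, Fin.ext_iff, penult, ult]; omega

/-- `f : {1, …, 2k} → {1, …, N}` is strongly admissible for `m` when, for distinct `a` and `b`,
`{a, b} ∈ m` if and only if `f a = f b`. -/
def StronglyAdmissible {k N : ℕ} (m : PairPartition k) (f : Fin (2 * k) → Fin N) : Prop :=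
  ∀ a b, a ≠ b → ({a, b} ∈ m.pairs ↔ f a = f b)

/-! ## The real Grassmannian and its normalised Haar measure -/

/-- `A(M, N)`: the idempotent real symmetric `N × N` matrices of rank `M`. -/
def Grassmannian (M N : ℕ) : Set (Matrix (Fin N) (Fin N) ℝ) :=
  {A | A * A = A ∧ A.transpose = A ∧ A.rank = M}

/-- `A(M, N)` carries the Borel sigma-algebra of its topology as a space of matrices. -/
instance (M N : ℕ) : MeasurableSpace (Grassmannian M N) := borel _

instance (M N : ℕ) : BorelSpace (Grassmannian M N) := ⟨rfl⟩

/-- The orthogonal group `O(N)`. -/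
abbrev O (N : ℕ) : Type := Matrix.orthogonalGroup (Fin N) ℝ

instance (N : ℕ) : MeasurableSpace (O N) := borel _

instance (N : ℕ) : BorelSpace (O N) := ⟨rfl⟩

instance (N : ℕ) : CompactSpace (O N) := by
  change CompactSpace (Matrix.orthogonalGroup (Fin N) ℝ : Set (Matrix (Fin N) (Fin N) ℝ))
  rw [← isCompact_iff_compactSpace]
  have hc : IsCompact (Set.univ.pi fun _ : Fin N => Set.univ.pi fun _ : Fin N =>
      Set.Icc (-1 : ℝ) 1) :=
    isCompact_univ_pi fun _ => isCompact_univ_pi fun _ => isCompact_Icc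
  refine IsCompact.of_isClosed_subset (s := (Set.univ.pi fun _ : Fin N =>
    Set.univ.pi fun _ : Fin N => Set.Icc (-1 : ℝ) 1 : Set (Fin N → Fin N → ℝ))) hc ?_ ?_
  · have : ((Matrix.orthogonalGroup (Fin N) ℝ : Set (Matrix (Fin N) (Fin N) ℝ))) =
        {A | A * A.transpose = 1} := by
      ext A; exact Matrix.mem_orthogonalGroup_iff (Fin N) ℝ
    change IsClosed (Matrix.orthogonalGroup (Fin N) ℝ : Set (Matrix (Fin N) (Fin N) ℝ))
    rw [this]
    exact isClosed_eq (by fun_prop) continuous_const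
  · intro A hA i _ j _
    have := entry_norm_bound_of_unitary hA i j
    exact abs_le.1 (by simpa using this)

/-- The normalised Haar measure on `O(N)`. -/
def haarO (N : ℕ) : Measure (O N) := Measure.haarMeasure ⊤

/-- `I_{M,N}`: the diagonal `N × N` matrix whose first `M` diagonal entries are `1` and whose other
entries are `0`. -/
def projMatrix (M N : ℕ) : Matrix (Fin N) (Fin N) ℝ :=
  Matrix.diagonal (fun i => if (i : ℕ) < M then 1 else 0)

theorem conj_mem_grassmannian {M N : ℕ} (h : M < N) (U : O N) :
    (U : Matrix (Fin N) (Fin N) ℝ) * projMatrix M N * (U : Matrix (Fin N) (Fin N) ℝ).transpose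
      ∈ Grassmannian M N := by
  have hU : (U : Matrix (Fin N) (Fin N) ℝ).transpose * (U : Matrix (Fin N) (Fin N) ℝ) = 1 :=
    (Matrix.mem_orthogonalGroup_iff' (Fin N) ℝ).1 U.2
  have hP : projMatrix M N * projMatrix M N = projMatrix M N := by
    simp [projMatrix, Matrix.diagonal_mul_diagonal]
  refine ⟨?_, ?_, ?_⟩
  · calc _ = (U : Matrix (Fin N) (Fin N) ℝ) * projMatrix M N *
          ((U : Matrix (Fin N) (Fin N) ℝ).transpose * (U : Matrix (Fin N) (Fin N) ℝ)) *
          projMatrix M N * (U : Matrix (Fin N) (Fin N) ℝ).transpose := by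
            simp only [Matrix.mul_assoc]
      _ = _ := by rw [hU, Matrix.mul_one, Matrix.mul_assoc _ (projMatrix M N) (projMatrix M N), hP]
  · simp [Matrix.transpose_mul, projMatrix, Matrix.mul_assoc]
  · have hd : IsUnit (U : Matrix (Fin N) (Fin N) ℝ).det :=
      Matrix.isUnit_det_of_left_inverse hU
    have hd' : IsUnit (U : Matrix (Fin N) (Fin N) ℝ).transpose.det := by
      rwa [Matrix.det_transpose]
    rw [Matrix.rank_mul_eq_left_of_isUnit_det _ _ hd', Matrix.rank_mul_eq_right_of_isUnit_det _ _ hd,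
      projMatrix, Matrix.rank_diagonal, Fintype.card_subtype]
    simp only [ne_eq, ite_eq_right_iff, one_ne_zero, imp_false, not_not]
    have := Fin.card_filter_val_lt (n := N) (m := M)
    rw [this]; omega

/-- The map `O(N) → A(M, N)`, `U ↦ U I_{M,N} Uᵀ`. -/
def orbitMap {M N : ℕ} (h : M < N) (U : O N) : Grassmannian M N :=
  ⟨_, conj_mem_grassmannian h U⟩

theorem continuous_orbitMap {M N : ℕ} (h : M < N) : Continuous (orbitMap h) := by
  unfold orbitMap
  fun_prop

/-- The `O(N)`-invariant probability measure on `A(M, N)` induced by the normalised Haar measure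
on `O(N)`. -/
def haarGr {M N : ℕ} (h : M < N) : Measure (Grassmannian M N) :=
  (haarO N).map (orbitMap h)

/-- The integral of `A_{f(1) f(2)} A_{f(3) f(4)} ⋯ A_{f(2k-1) f(2k)}` over `A(M, N)`. -/
def monomialIntegral {M N : ℕ} (h : M < N) {k : ℕ} (f : Fin (2 * k) → Fin N) : ℝ :=
  ∫ A : Grassmannian M N,
    ∏ s : Fin k, (A : Matrix (Fin N) (Fin N) ℝ) (f ⟨2 * s, by omega⟩) (f ⟨2 * s + 1, by omega⟩)
    ∂(haarGr h)

/-! ## The Weingarten function -/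

/-- The field `ℝ(M, N)` of rational functions in two variables. -/
abbrev RatMN : Type := FractionRing (MvPolynomial (Fin 2) ℝ)

/-- The variable `M` of `ℝ(M, N)`. -/
def varM : RatMN := algebraMap (MvPolynomial (Fin 2) ℝ) RatMN (MvPolynomial.X 0)

/-- The variable `N` of `ℝ(M, N)`. -/
def varN : RatMN := algebraMap (MvPolynomial (Fin 2) ℝ) RatMN (MvPolynomial.X 1)

/-- The rational function `W` is regular at the point `(x, y)` and takes the value `r` there. -/
def HasValueAt (W : RatMN) (x y r : ℝ) : Prop :=
  ∃ p q : MvPolynomial (Fin 2) ℝ, MvPolynomial.eval ![x, y] q ≠ 0 ∧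
    W = algebraMap _ RatMN p / algebraMap _ RatMN q ∧
    r = MvPolynomial.eval ![x, y] p / MvPolynomial.eval ![x, y] q

/-- The rational function `W` is the value at `m` of the Weingarten function: for all `M < N` with
`k ≤ N`, it takes at `(M, N)` the value `∫ A_{f(1) f(2)} ⋯ A_{f(2k-1) f(2k)}` over `A(M, N)`,
for every function `f` that is strongly admissible for `m`. -/
def IsWeingartenValue {k : ℕ} (m : PairPartition k) (W : RatMN) : Prop :=
  ∀ (M N : ℕ) (h : M < N), k ≤ N → ∀ f : Fin (2 * k) → Fin N, StronglyAdmissible m f →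
    HasValueAt W M N (monomialIntegral h f)

open Classical in
/-- The Weingarten function `P_• → ℝ(M, N)`, whose value at `m` is the rational function `W` with
`IsWeingartenValue m W`. -/
def WgA {k : ℕ} (m : PairPartition k) : RatMN :=
  if h : ∃ W, IsWeingartenValue m W then h.choose else 0

end GrassmannWeingarten

end

/-!
Write `E f` for the average of `A_{f(1) f(2)} ⋯ A_{f(2k-1) f(2k)}`. By invariance of the Haar
measure, `E` is a tensor with `2k` indices that is invariant under `O(N)`, and everything follows
from the infinitesimal form of this invariance, `IsInvariant.rotation`: for `v ≠ l`, moving one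
index with value `v` to `l`, summed over all such indices, gives the same as moving one index with
value `l` to `v`.

*Existence.* If some value of `f` is taken at least four times and `k ≤ N`, there is an unused
value `l`, and the rotations towards `l` express `E f` through index functions with more values.
Hence an invariant tensor that vanishes at all strongly admissible index functions is zero
(`IsInvariant.eq_zero`), and `E` is the combination of the pair partition tensors, with the
coefficients `E f` for `f` strongly admissible (`IsInvariant.eq_sum_pairTensor`). This replaces the
first fundamental theorem of invariant theory for the orthogonal group. Pairing with
the pair partition tensors gives a linear system for the coefficients: its matrix is the Gram matrix
of these tensors, whose entries are powers of `N`, and its right-hand side consists of powers of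
`M`, because invariance lets the projection be replaced by `I_{M,N}`. Strongly admissible index
functions show that the tensors are linearly independent for `k ≤ N`, so the Gram determinant does
not vanish there (`det_gram_ne_zero`), and Cramer's rule gives the rational function
(`exists_isWeingartenValue`). It is unique because the points `(M, N)` are Zariski dense
(`eq_of_hasValueAt`).

*Orthogonality relations.* Let `f` be strongly admissible for `m` and let `q` be the partner of
`2k-1`. The sum of `E` over a common value of the positions `2k-1` and `q` is computed in two ways.
By infinitesimal invariance it is `N E(f)` plus the terms of the transpositions `(i 2k-1)`
(`IsInvariant.contract`). On the other hand it is a trace, equal to `M`, if `q = 2k`, and otherwise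
a matrix product of two factors `A`, which collapses by `A² = A`. Comparison at all `(M, N)` gives
the identity of rational functions.
-/

namespace GrassmannWeingarten

/-! ### Orthogonally invariant tensors -/

section Invariant

variable {ι : Type*} [Fintype ι] [DecidableEq ι] {N : ℕ}

/-- A tensor on `ℝ^N`, with index positions `ι` and coordinates `D f`, is invariant when each
orthogonal matrix, acting on all positions at once, fixes it. -/
def IsInvariant (D : (ι → Fin N) → ℝ) : Prop :=
  ∀ (U : O N) (f : ι → Fin N),
    ∑ g : ι → Fin N, (∏ a, (U : Matrix (Fin N) (Fin N) ℝ) (f a) (g a)) * D g = D f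

theorem IsInvariant.sub {D D' : (ι → Fin N) → ℝ} (h : IsInvariant D) (h' : IsInvariant D') :
    IsInvariant (fun f => D f - D' f) := by
  intro U f
  simp only [mul_sub, Finset.sum_sub_distrib, h U f, h' U f]

theorem IsInvariant.sum {κ : Type*} (s : Finset κ) (c : κ → ℝ) {D : κ → (ι → Fin N) → ℝ}
    (h : ∀ i, IsInvariant (D i)) : IsInvariant (fun f => ∑ i ∈ s, c i * D i f) := by
  intro U f
  simp only [Finset.mul_sum]
  rw [Finset.sum_comm]
  refine Finset.sum_congr rfl fun i _ => ?_
  rw [← h i U f, Finset.mul_sum]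
  exact Finset.sum_congr rfl fun g _ => by ring

/-- Invariance under permutation matrices. -/
theorem IsInvariant.perm {D : (ι → Fin N) → ℝ} (h : IsInvariant D) (σ : Equiv.Perm (Fin N))
    (f : ι → Fin N) : D (σ ∘ f) = D f := by
  have hU : (Matrix.of fun i j => if σ i = j then (1 : ℝ) else 0) ∈
      Matrix.orthogonalGroup (Fin N) ℝ := by
    rw [Matrix.mem_orthogonalGroup_iff]
    ext i j
    simp [Matrix.mul_apply, Matrix.one_apply, eq_comm]
  rw [← h ⟨_, hU⟩ f, Fintype.sum_eq_single (σ ∘ f)]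
  · simp
  · intro g hg
    obtain ⟨a, ha⟩ := Function.ne_iff.1 hg
    rw [Finset.prod_eq_zero (Finset.mem_univ a), zero_mul]
    simpa using Ne.symm ha

/-- Invariance under the reflection of one coordinate axis. -/
theorem IsInvariant.eq_zero_of_odd {D : (ι → Fin N) → ℝ} (h : IsInvariant D)
    (f : ι → Fin N) (v : Fin N) (hv : Odd (Finset.univ.filter fun a => f a = v).card) :
    D f = 0 := by
  have hU : (Matrix.diagonal fun i => if i = v then (-1 : ℝ) else 1) ∈
      Matrix.orthogonalGroup (Fin N) ℝ := by
    rw [Matrix.mem_orthogonalGroup_iff]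
    ext i j
    simp only [Matrix.diagonal_transpose,
      Matrix.diagonal_mul_diagonal, Matrix.diagonal_apply, Matrix.one_apply]
    split_ifs <;> simp_all
  have e := h ⟨_, hU⟩ f
  rw [Fintype.sum_eq_single f] at e
  · simp only [Matrix.diagonal_apply_eq, Finset.prod_ite, Finset.prod_const, one_pow, mul_one,
      hv.neg_one_pow] at e
    linarith
  · intro g hg
    obtain ⟨a, ha⟩ := Function.ne_iff.1 hg
    rw [Finset.prod_eq_zero (Finset.mem_univ a), zero_mul]
    simpa [Matrix.diagonal_apply] using fun h => absurd h.symm ha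

/-- The rotation by the angle `t` in the plane of the coordinates `v` and `l`. -/
noncomputable def planeRotation (v l : Fin N) (t : ℝ) : Matrix (Fin N) (Fin N) ℝ :=
  1 + Real.sin t • (Matrix.single v l 1 - Matrix.single l v 1) +
    (Real.cos t - 1) • (Matrix.single v v 1 + Matrix.single l l 1)

theorem planeRotation_mem {v l : Fin N} (hvl : v ≠ l) (t : ℝ) :
    planeRotation v l t ∈ Matrix.orthogonalGroup (Fin N) ℝ := by
  rw [Matrix.mem_orthogonalGroup_iff]
  have hT : (planeRotation v l t).transpose =
      1 - Real.sin t • (Matrix.single v l 1 - Matrix.single l v 1) +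
        (Real.cos t - 1) • (Matrix.single v v 1 + Matrix.single l l 1) := by
    simp only [planeRotation, Matrix.transpose_add,
      Matrix.transpose_smul, Matrix.transpose_sub, Matrix.transpose_single, Matrix.transpose_one]
    module
  rw [hT, planeRotation]
  simp only [mul_add, add_mul, mul_sub, sub_mul, mul_one, one_mul, Matrix.smul_mul,
    Matrix.mul_smul, Matrix.single_mul_single_same, smul_add, smul_sub,
    Matrix.single_mul_single_of_ne (1 : ℝ) _ _ _ hvl,
    Matrix.single_mul_single_of_ne (1 : ℝ) _ _ _ hvl.symm, smul_zero]
  have hs := Real.sin_sq_add_cos_sq t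
  have hs' : Real.sin t * Real.sin t = 1 - Real.cos t * Real.cos t := by linarith
  match_scalars <;> first | ring1 | linear_combination hs'

theorem hasDerivAt_planeRotation (v l i j : Fin N) :
    HasDerivAt (fun t => planeRotation v l t i j)
      ((Matrix.single v l (1 : ℝ) - Matrix.single l v 1 : Matrix (Fin N) (Fin N) ℝ) i j) 0 := by
  have h1 := (Real.hasDerivAt_sin 0).mul_const
    ((Matrix.single v l (1 : ℝ) - Matrix.single l v 1 : Matrix (Fin N) (Fin N) ℝ) i j)
  have h2 := ((Real.hasDerivAt_cos 0).sub_const 1).mul_const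
    ((Matrix.single v v (1 : ℝ) + Matrix.single l l 1 : Matrix (Fin N) (Fin N) ℝ) i j)
  have h3 := (h1.const_add ((1 : Matrix (Fin N) (Fin N) ℝ) i j)).add h2
  simp only [Real.cos_zero, Real.sin_zero, one_mul, neg_zero, zero_mul, add_zero] at h3
  exact h3

/-- The infinitesimal form of invariance: the derivative at the identity of the action of the
rotations in the plane of the coordinates `v` and `l`. -/
theorem IsInvariant.rotation {D : (ι → Fin N) → ℝ} (h : IsInvariant D)
    {v l : Fin N} (hvl : v ≠ l) (f : ι → Fin N) :
    ∑ a with f a = v, D (Function.update f a l) = ∑ a with f a = l, D (Function.update f a v) := by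
  have h0 : HasDerivAt (fun _ : ℝ => D f) 0 0 := hasDerivAt_const _ _
  have h1 : HasDerivAt (fun t : ℝ => ∑ g : ι → Fin N, (∏ a, planeRotation v l t (f a) (g a)) * D g)
      (∑ g : ι → Fin N, (∑ a, (∏ b ∈ Finset.univ.erase a, planeRotation v l 0 (f b) (g b)) •
        ((Matrix.single v l (1 : ℝ) - Matrix.single l v 1 : Matrix (Fin N) (Fin N) ℝ)
          (f a) (g a))) * D g) 0 :=
    HasDerivAt.fun_sum fun g _ => (HasDerivAt.fun_finsetProd
      fun a _ => hasDerivAt_planeRotation v l (f a) (g a)).mul_const _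
  have h2 : (fun t : ℝ => ∑ g : ι → Fin N, (∏ a, planeRotation v l t (f a) (g a)) * D g) =
      fun _ => D f := funext fun t => h ⟨_, planeRotation_mem hvl t⟩ f
  rw [h2] at h1
  have e := h1.unique h0
  have hR : planeRotation v l 0 = 1 := by simp [planeRotation]
  simp only [hR, Finset.sum_mul, smul_eq_mul] at e
  rw [Finset.sum_comm] at e
  have key : ∀ a, ∑ g : ι → Fin N, (∏ b ∈ Finset.univ.erase a,
      (1 : Matrix (Fin N) (Fin N) ℝ) (f b) (g b)) *
        ((Matrix.single v l (1 : ℝ) - Matrix.single l v 1 : Matrix (Fin N) (Fin N) ℝ)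
          (f a) (g a)) * D g =
      (if f a = v then D (Function.update f a l) else 0) -
        (if f a = l then D (Function.update f a v) else 0) := by
    intro a
    rw [← Fintype.sum_of_injective (fun x => Function.update f a x)
      (Function.update_injective f a) (fun x => (Matrix.single v l (1 : ℝ) - Matrix.single l v 1 :
        Matrix (Fin N) (Fin N) ℝ) (f a) x * D (Function.update f a x))]
    · simp only [Matrix.sub_apply, sub_mul, Finset.sum_sub_distrib, Matrix.single_apply,
        ite_mul, one_mul, zero_mul, ite_and, eq_comm (a := v), eq_comm (a := l)]
      congr 1 <;> split_ifs <;> simp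
    · intro g hg
      have : ∃ b, b ≠ a ∧ f b ≠ g b := by
        by_contra hc
        push Not at hc
        refine hg ⟨g a, funext fun b => ?_⟩
        by_cases hb : b = a
        · subst hb; simp
        · simp [hb, hc b hb]
      obtain ⟨b, hb, hne⟩ := this
      rw [Finset.prod_eq_zero (Finset.mem_erase.2 ⟨hb, Finset.mem_univ b⟩), zero_mul, zero_mul]
      exact Matrix.one_apply_ne hne
    · intro x
      rw [Finset.prod_eq_one, one_mul, Function.update_self]
      intro b hb
      rw [Function.update_of_ne (Finset.ne_of_mem_erase hb), Matrix.one_apply_eq]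
  simp only [key, Finset.sum_sub_distrib] at e
  rw [Finset.sum_filter, Finset.sum_filter]
  linarith

/-- An invariant tensor of order `2 k ≤ 2 N` that vanishes at all index functions whose
nonempty fibres have two elements is zero.  Reflections rule out fibres of odd size.  A fibre with
at least four elements leaves an
unused value `l`, and rotating towards `l` writes the coordinate as a sum of coordinates in which a
pair of that fibre has been moved to `l`; this increases the number of values. -/
theorem IsInvariant.eq_zero {D : (ι → Fin N) → ℝ} (h : IsInvariant D) {k : ℕ}
    (hk : Fintype.card ι = 2 * k) (hkN : k ≤ N)
    (h2 : ∀ f : ι → Fin N, (∀ a, (Finset.univ.filter fun b => f b = f a).card = 2) → D f = 0)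
    (f : ι → Fin N) : D f = 0 := by
  induction hn : N - (Finset.univ.image f).card using Nat.strong_induction_on generalizing f with
  | _ n ih =>
  by_cases hodd : ∃ v, Odd (Finset.univ.filter fun a => f a = v).card
  · obtain ⟨v, hv⟩ := hodd
    exact h.eq_zero_of_odd f v hv
  push Not at hodd
  by_cases htwo : ∀ a, (Finset.univ.filter fun b => f b = f a).card = 2
  · exact h2 f htwo
  push Not at htwo
  obtain ⟨a₀, ha₀⟩ := htwo
  have hge : ∀ v ∈ Finset.univ.image f, 2 ≤ (Finset.univ.filter fun b => f b = v).card := by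
    intro v hv
    obtain ⟨a, -, rfl⟩ := Finset.mem_image.1 hv
    obtain ⟨r, hr⟩ := Nat.not_odd_iff_even.1 (hodd (f a))
    have : 0 < (Finset.univ.filter fun b => f b = f a).card := Finset.card_pos.2 ⟨a, by simp⟩
    omega
  have h4 : 4 ≤ (Finset.univ.filter fun b => f b = f a₀).card := by
    obtain ⟨r, hr⟩ := Nat.not_odd_iff_even.1 (hodd (f a₀))
    have := hge (f a₀) (by simp)
    omega
  have hsum := Finset.card_eq_sum_card_image f Finset.univ
  rw [Finset.card_univ, hk] at hsum
  have hlt : ∑ v ∈ Finset.univ.image f, 2 <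
      ∑ v ∈ Finset.univ.image f, (Finset.univ.filter fun b => f b = v).card :=
    Finset.sum_lt_sum hge ⟨f a₀, by simp, by omega⟩
  rw [← hsum, Finset.sum_const, smul_eq_mul] at hlt
  have hcard : (Finset.univ.image f).card < N := by omega
  obtain ⟨l, hl⟩ : ∃ l, l ∉ Finset.univ.image f := by
    by_contra hc
    push Not at hc
    rw [Finset.eq_univ_of_forall hc, Finset.card_univ, Fintype.card_fin] at hcard
    exact lt_irrefl _ hcard
  have hl' : ∀ a, f a ≠ l := fun a ha => hl (Finset.mem_image.2 ⟨a, Finset.mem_univ a, ha⟩)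
  have e := h.rotation (hl' a₀) (Function.update f a₀ l)
  have hr : (Finset.univ.filter fun a => Function.update f a₀ l a = l) = {a₀} := by
    ext a
    by_cases ha : a = a₀
    · simp [ha]
    · simp [ha, hl']
  rw [hr, Finset.sum_singleton, Function.update_idem, Function.update_eq_self] at e
  rw [← e]
  refine Finset.sum_eq_zero fun a ha => ?_
  refine ih _ ?_ _ rfl
  have hsub : insert l (Finset.univ.image f) ⊆
      Finset.univ.image (Function.update (Function.update f a₀ l) a l) := by
    intro v hv
    rcases Finset.mem_insert.1 hv with rfl | hv
    · exact Finset.mem_image.2 ⟨a, Finset.mem_univ a, by simp⟩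
    · obtain ⟨c, hc⟩ : ∃ c, f c = v ∧ c ≠ a₀ ∧ c ≠ a := by
        obtain ⟨b, -, hb⟩ := Finset.mem_image.1 hv
        have hfa : f a = f a₀ := by
          have := (Finset.mem_filter.1 ha).2
          rw [Function.update_apply] at this
          split_ifs at this with haa
          · exact congrArg f haa
          · exact this
        by_cases hva : v = f a₀
        · have : 0 < ((Finset.univ.filter fun b => f b = f a₀) \ {a₀, a}).card := by
            have h1 := Finset.le_card_sdiff {a₀, a} (Finset.univ.filter fun b => f b = f a₀)
            have h2 := Finset.card_le_two (a := a₀) (b := a)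
            omega
          obtain ⟨c, hc⟩ := Finset.card_pos.1 this
          simp only [Finset.mem_sdiff, Finset.mem_filter, Finset.mem_univ, true_and,
            Finset.mem_insert, Finset.mem_singleton, not_or] at hc
          exact ⟨c, hc.1.trans hva.symm, hc.2⟩
        · refine ⟨b, hb, ?_, ?_⟩
          · rintro rfl; exact hva hb.symm
          · rintro rfl; exact hva (hb.symm.trans hfa)
      exact Finset.mem_image.2 ⟨c, Finset.mem_univ c, by simp [hc]⟩
  have := Finset.card_le_card hsub
  rw [Finset.card_insert_of_notMem hl] at this
  omega

end Invariant

/-! ### Pair partitions and their tensors -/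

namespace PairPartition

variable {k : ℕ} (m : PairPartition k)

theorem eq_of_mem {p q : Finset (Fin (2 * k))} (hp : p ∈ m.pairs) (hq : q ∈ m.pairs)
    {a : Fin (2 * k)} (hap : a ∈ p) (haq : a ∈ q) : p = q :=
  (m.existsUnique_mem a).unique ⟨hp, hap⟩ ⟨hq, haq⟩

theorem ne_of_pair_mem {a b : Fin (2 * k)} (h : {a, b} ∈ m.pairs) : a ≠ b := by
  rintro rfl
  simpa using m.card_eq_two _ h

theorem exists_pair_mem (a : Fin (2 * k)) : ∃ b, {a, b} ∈ m.pairs := by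
  obtain ⟨p, ⟨hp, hap⟩, -⟩ := m.existsUnique_mem a
  obtain ⟨x, y, -, rfl⟩ := Finset.card_eq_two.1 (m.card_eq_two p hp)
  simp only [Finset.mem_insert, Finset.mem_singleton] at hap
  rcases hap with rfl | rfl
  · exact ⟨y, hp⟩
  · exact ⟨x, by rwa [Finset.pair_comm]⟩

theorem eq_of_pair_mem {a b c : Fin (2 * k)} (h : {a, b} ∈ m.pairs) (h' : {a, c} ∈ m.pairs) :
    b = c := by
  have e := m.eq_of_mem h h' (Finset.mem_insert_self a _) (Finset.mem_insert_self a _)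
  have hb : b ∈ ({a, c} : Finset _) := e ▸ (by simp)
  have := m.ne_of_pair_mem h
  simp only [Finset.mem_insert, Finset.mem_singleton] at hb
  tauto

theorem eq_of_pairs_subset {m n : PairPartition k} (h : m.pairs ⊆ n.pairs) : m = n := by
  refine PairPartition.ext (Finset.Subset.antisymm h fun p hp => ?_)
  obtain ⟨a, ha⟩ := Finset.card_pos.1 (by rw [n.card_eq_two p hp]; norm_num)
  obtain ⟨q, ⟨hq, haq⟩, -⟩ := m.existsUnique_mem a
  rwa [n.eq_of_mem hp (h hq) ha haq]

theorem pair_mem_smul_iff (σ : Equiv.Perm (Fin (2 * k))) {a b : Fin (2 * k)} :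
    {a, b} ∈ (σ • m).pairs ↔ {σ.symm a, σ.symm b} ∈ m.pairs := by
  constructor
  · intro h
    obtain ⟨p, hp, e⟩ := Finset.mem_image.1 h
    have : p = {σ.symm a, σ.symm b} := by
      apply Finset.map_injective σ.toEmbedding
      rw [e]; simp
    rwa [← this]
  · intro h
    simpa using pair_mem_smul σ h

theorem pair_mem_down_iff {m : PairPartition (k + 1)} (h : {penult k, ult k} ∈ m.pairs)
    {a b : Fin (2 * k)} : {a, b} ∈ (m.down h).pairs ↔ {incl k a, incl k b} ∈ m.pairs := by
  simp [down]

open Classical in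
noncomputable instance : Fintype (PairPartition k) :=
  Fintype.ofInjective PairPartition.pairs fun _ _ h => PairPartition.ext h

/-- The pair of `m` that contains `a`. -/
noncomputable def pairOf (a : Fin (2 * k)) : m.pairs :=
  ⟨(m.existsUnique_mem a).choose, (m.existsUnique_mem a).choose_spec.1.1⟩

theorem pairOf_eq_iff {a : Fin (2 * k)} {p : m.pairs} : m.pairOf a = p ↔ a ∈ p.1 := by
  have h := (m.existsUnique_mem a).choose_spec.1.2
  constructor
  · rintro rfl; exact h
  · intro hp
    exact Subtype.ext (m.eq_of_mem (m.pairOf a).2 p.2 h hp)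

theorem pairOf_surjective : Function.Surjective m.pairOf := by
  intro p
  obtain ⟨a, ha⟩ := Finset.card_pos.1 (by rw [m.card_eq_two p.1 p.2]; norm_num)
  exact ⟨a, m.pairOf_eq_iff.2 ha⟩

end PairPartition

/-- An index function is admissible for `m` when it is constant on each pair of `m`. -/
def Admissible {k N : ℕ} (m : PairPartition k) (f : Fin (2 * k) → Fin N) : Prop :=
  ∀ p ∈ m.pairs, ∀ a ∈ p, ∀ b ∈ p, f a = f b

open Classical in
/-- The tensor of a pair partition: the product of the Kronecker deltas of its pairs. -/
noncomputable def pairTensor {k N : ℕ} (m : PairPartition k) (f : Fin (2 * k) → Fin N) : ℝ :=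
  if Admissible m f then 1 else 0

theorem isInvariant_pairTensor {k N : ℕ} (m : PairPartition k) :
    IsInvariant (pairTensor (N := N) m) := by
  classical
  intro U f
  have hU : (U : Matrix (Fin N) (Fin N) ℝ) * (U : Matrix (Fin N) (Fin N) ℝ).transpose = 1 :=
    (Matrix.mem_orthogonalGroup_iff (Fin N) ℝ).1 U.2
  -- Only the index functions that are constant on the pairs contribute; they factor through
  -- `m.pairOf`.
  have h1 : ∑ g : m.pairs → Fin N, ∏ p : m.pairs, ∏ a ∈ p.1,
      (U : Matrix (Fin N) (Fin N) ℝ) (f a) (g p) =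
      ∑ g : Fin (2 * k) → Fin N,
        (∏ a, (U : Matrix (Fin N) (Fin N) ℝ) (f a) (g a)) * pairTensor m g := by
    refine Fintype.sum_of_injective (fun g => g ∘ m.pairOf)
      (m.pairOf_surjective.injective_comp_right) _ _ ?_ ?_
    · intro g hg
      rw [pairTensor, if_neg, mul_zero]
      intro hadm
      refine hg ⟨fun p => g (m.pairOf_surjective p).choose, funext fun a => ?_⟩
      have := (m.pairOf_surjective (m.pairOf a)).choose_spec
      exact hadm _ (m.pairOf a).2 _ (m.pairOf_eq_iff.1 this) _ (m.pairOf_eq_iff.1 rfl)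
    · intro g
      rw [pairTensor, if_pos, mul_one, ← Finset.prod_fiberwise Finset.univ m.pairOf]
      · refine Finset.prod_congr rfl fun p _ => ?_
        refine Finset.prod_congr_of_eq_on_inter ?_ ?_ ?_
        · intro a ha hn
          simp [m.pairOf_eq_iff, ha] at hn
        · intro a ha hn
          simp [m.pairOf_eq_iff, hn] at ha
        · intro a ha _
          simp [m.pairOf_eq_iff.2 ha]
      · intro p hp a ha b hb
        simp [(m.pairOf_eq_iff (p := ⟨p, hp⟩)).2 ha, (m.pairOf_eq_iff (p := ⟨p, hp⟩)).2 hb]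
  rw [← h1]
  have h2 := Finset.prod_univ_sum (fun _ : m.pairs => (Finset.univ : Finset (Fin N)))
    (fun p v => ∏ a ∈ p.1, (U : Matrix (Fin N) (Fin N) ℝ) (f a) v)
  rw [Fintype.piFinset_univ] at h2
  rw [← h2]
  have h3 : ∀ p : m.pairs, ∑ v, ∏ a ∈ p.1, (U : Matrix (Fin N) (Fin N) ℝ) (f a) v =
      if ∀ a ∈ p.1, ∀ b ∈ p.1, f a = f b then 1 else 0 := by
    rintro ⟨p, hp⟩
    obtain ⟨x, y, hxy, rfl⟩ := Finset.card_eq_two.1 (m.card_eq_two p hp)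
    have := congrFun (congrFun hU (f x)) (f y)
    rw [Matrix.mul_apply, Matrix.one_apply] at this
    simp only [Finset.prod_pair hxy, Matrix.transpose_apply] at this ⊢
    rw [this]
    congr 1
    refine propext ⟨fun h => by simp [h], fun h => h x (by simp) y (by simp)⟩
  simp only [h3, Finset.prod_boole, pairTensor, Admissible]
  congr 1
  simp

theorem StronglyAdmissible.pairTensor_eq {k N : ℕ} {n : PairPartition k}
    {f : Fin (2 * k) → Fin N} (hf : StronglyAdmissible n f) (m : PairPartition k)
    [Decidable (m = n)] :
    pairTensor m f = if m = n then 1 else 0 := by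
  classical
  rw [pairTensor]
  congr 1
  refine propext ⟨fun h => ?_, ?_⟩
  · refine PairPartition.eq_of_pairs_subset fun p hp => ?_
    obtain ⟨x, y, hxy, rfl⟩ := Finset.card_eq_two.1 (m.card_eq_two p hp)
    exact (hf x y hxy).2 (h _ hp x (by simp) y (by simp))
  · rintro rfl p hp a ha b hb
    obtain ⟨x, y, hxy, rfl⟩ := Finset.card_eq_two.1 (m.card_eq_two p hp)
    have := (hf x y hxy).1 hp
    simp only [Finset.mem_insert, Finset.mem_singleton] at ha hb
    rcases ha with rfl | rfl <;> rcases hb with rfl | rfl <;> simp [this]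

theorem StronglyAdmissible.exists_perm {k N : ℕ} {m : PairPartition k}
    {f g : Fin (2 * k) → Fin N} (hf : StronglyAdmissible m f) (hg : StronglyAdmissible m g) :
    ∃ σ : Equiv.Perm (Fin N), σ ∘ f = g := by
  classical
  have hfg : ∀ a b, f a = f b ↔ g a = g b := by
    intro a b
    by_cases hab : a = b
    · simp [hab]
    · rw [← hf a b hab, hg a b hab]
  have hlift : ∀ a, Function.extend f g id (f a) = g a := fun a =>
    Function.FactorsThrough.extend_apply (fun x y hxy => (hfg x y).1 hxy) _ a
  let φ : {x // x ∈ Set.range f} → Fin N := fun x => Function.extend f g id x.1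
  have hφ : Function.Injective φ := by
    rintro ⟨_, a, rfl⟩ ⟨_, b, rfl⟩ h
    simp only [φ, hlift] at h
    exact Subtype.ext ((hfg a b).2 h)
  refine ⟨(Equiv.ofInjective φ hφ).extendSubtype, funext fun a => ?_⟩
  rw [Function.comp_apply,
    Equiv.extendSubtype_apply_of_mem _ _ (show f a ∈ Set.range f from ⟨a, rfl⟩)]
  exact hlift a

/-- Strongly admissible index functions exist as soon as there is room for `k` values. -/
theorem exists_stronglyAdmissible {k N : ℕ} (m : PairPartition k) (hN : k ≤ N) :
    ∃ f : Fin (2 * k) → Fin N, StronglyAdmissible m f := by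
  classical
  have hc : Fintype.card m.pairs = k := by
    have h := Finset.card_eq_sum_card_fiberwise (f := m.pairOf) (s := Finset.univ)
      (t := Finset.univ) (fun _ _ => Finset.mem_coe.2 (Finset.mem_univ _))
    have h' : ∀ p : m.pairs, (Finset.univ.filter fun a => m.pairOf a = p).card = 2 := by
      intro p
      refine Eq.trans (congrArg Finset.card ?_) (m.card_eq_two p.1 p.2)
      ext a
      simp [m.pairOf_eq_iff]
    simp only [h', Finset.sum_const, Finset.card_univ, Fintype.card_fin, smul_eq_mul] at h
    omega
  obtain ⟨e⟩ := Function.Embedding.nonempty_of_card_le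
    (show Fintype.card m.pairs ≤ Fintype.card (Fin N) by rw [hc, Fintype.card_fin]; exact hN)
  refine ⟨e ∘ m.pairOf, fun a b hab => ?_⟩
  simp only [Function.comp_apply, e.injective.eq_iff, m.pairOf_eq_iff]
  obtain ⟨c, hc⟩ := m.exists_pair_mem b
  have : m.pairOf b = ⟨_, hc⟩ := m.pairOf_eq_iff.2 (by simp)
  rw [this]
  simp only [Finset.mem_insert, Finset.mem_singleton, hab, false_or]
  constructor
  · intro h
    rw [Finset.pair_comm] at h
    exact m.eq_of_pair_mem h hc
  · rintro rfl
    rwa [Finset.pair_comm]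

/-- An index function whose nonempty fibres have two elements is strongly admissible for the pair
partition into its fibres. -/
theorem exists_stronglyAdmissible_of_fibres {k N : ℕ} (f : Fin (2 * k) → Fin N)
    (hf : ∀ a, (Finset.univ.filter fun b => f b = f a).card = 2) :
    ∃ m : PairPartition k, StronglyAdmissible m f := by
  refine ⟨⟨Finset.univ.image fun a => Finset.univ.filter fun b => f b = f a, ?_, ?_⟩, ?_⟩
  · intro p hp
    obtain ⟨a, -, rfl⟩ := Finset.mem_image.1 hp
    exact hf a
  · intro a
    refine ⟨Finset.univ.filter fun b => f b = f a, ⟨Finset.mem_image_of_mem _ (by simp), by simp⟩,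
      ?_⟩
    rintro q ⟨hq, haq⟩
    obtain ⟨c, -, rfl⟩ := Finset.mem_image.1 hq
    rw [(Finset.mem_filter.1 haq).2]
  · intro a b hab
    simp only [Finset.mem_image, Finset.mem_univ, true_and]
    constructor
    · rintro ⟨c, hc⟩
      have ha : a ∈ Finset.univ.filter fun b => f b = f c := by rw [hc]; simp
      have hb : b ∈ Finset.univ.filter fun b => f b = f c := by rw [hc]; simp
      rw [(Finset.mem_filter.1 ha).2, (Finset.mem_filter.1 hb).2]
    · intro h
      refine ⟨a, (Finset.eq_of_subset_of_card_le ?_ ?_).symm⟩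
      · intro c hc
        simp only [Finset.mem_insert, Finset.mem_singleton] at hc
        rcases hc with rfl | rfl <;> simp [h]
      · rw [hf a, Finset.card_pair hab]

/-- In the stable range, an invariant tensor is the combination of the tensors of the pair
partitions, with its coordinates at strongly admissible index functions as coefficients. -/
theorem IsInvariant.eq_sum_pairTensor {k N : ℕ} (hkN : k ≤ N) {D : (Fin (2 * k) → Fin N) → ℝ}
    (hD : IsInvariant D) {F : PairPartition k → Fin (2 * k) → Fin N}
    (hF : ∀ m, StronglyAdmissible m (F m)) (f : Fin (2 * k) → Fin N) :
    D f = ∑ m, D (F m) * pairTensor m f := by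
  classical
  have h := hD.sub (IsInvariant.sum Finset.univ (fun m => D (F m)) isInvariant_pairTensor)
  refine sub_eq_zero.1 (h.eq_zero (k := k) (by simp) hkN (fun g hg => ?_) f)
  obtain ⟨n, hn⟩ := exists_stronglyAdmissible_of_fibres g hg
  obtain ⟨σ, hσ⟩ := (hF n).exists_perm hn
  have hDg : D g = D (F n) := by rw [← hσ, hD.perm σ (F n)]
  simp [hn.pairTensor_eq, hDg]

/-- The number of functions with values in `S` that respect a relation is a power of `#S`. -/
theorem sum_respecting {α β : Type*} [Fintype α] [DecidableEq α] [Fintype β] (r : α → α → Prop)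
    (S : Finset β) [DecidablePred fun f : α → β => (∀ a b, r a b → f a = f b) ∧ ∀ a, f a ∈ S] :
    ∑ f : α → β, (if (∀ a b, r a b → f a = f b) ∧ ∀ a, f a ∈ S then (1 : ℝ) else 0) =
      (S.card : ℝ) ^ Nat.card (Quot r) := by
  classical
  have : Fintype (Quot r) := Fintype.ofFinite _
  have h : (Fintype.piFinset fun _ : Quot r => S).card = S.card ^ Nat.card (Quot r) := by
    rw [Fintype.card_piFinset, Finset.prod_const, Finset.card_univ, Nat.card_eq_fintype_card]
  rw [Finset.sum_boole, ← Nat.cast_pow, ← h, Nat.cast_inj]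
  refine Finset.card_bij' (t := Fintype.piFinset fun _ : Quot r => S)
    (fun f hf => Quot.lift f (Finset.mem_filter.1 hf).2.1) (fun g _ a => g (Quot.mk r a)) ?_ ?_ ?_ ?_
  · intro f hf
    refine Fintype.mem_piFinset.2 fun q => ?_
    induction q using Quot.ind
    exact (Finset.mem_filter.1 hf).2.2 _
  · intro g hg
    refine Finset.mem_filter.2 ⟨Finset.mem_univ _, fun a b hab => ?_, fun a => ?_⟩
    · exact congrArg g (Quot.sound hab)
    · exact Fintype.mem_piFinset.1 hg _
  · intro f hf; rfl
  · intro g hg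
    funext q
    induction q using Quot.ind
    rfl

/-! ### Monomials in the entries of a matrix and their averages -/

/-- The product `A_{f(1) f(2)} A_{f(3) f(4)} ⋯ A_{f(2k-1) f(2k)}`. -/
def entryMonomial {N k : ℕ} (A : Matrix (Fin N) (Fin N) ℝ) (f : Fin (2 * k) → Fin N) : ℝ :=
  ∏ s : Fin k, A (f ⟨2 * s, by omega⟩) (f ⟨2 * s + 1, by omega⟩)

@[to_additive]
theorem prod_univ_penult_ult {R : Type*} [CommMonoid R] {k : ℕ} (F : Fin (2 * (k + 1)) → R) :
    ∏ a, F a = (∏ a : Fin (2 * k), F (incl k a)) * F (penult k) * F (ult k) :=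
  (Fin.prod_univ_castSucc (n := 2 * k + 1) F).trans
    (congrArg (· * F (ult k)) (Fin.prod_univ_castSucc (n := 2 * k) _))

theorem prod_fin_two_mul {R : Type*} [CommMonoid R] {k : ℕ} (F : Fin (2 * k) → R) :
    ∏ a, F a = ∏ s : Fin k, F ⟨2 * s, by omega⟩ * F ⟨2 * s + 1, by omega⟩ := by
  induction k with
  | zero => rfl
  | succ k ih =>
    rw [Fin.prod_univ_castSucc (n := k), prod_univ_penult_ult, ih, mul_assoc]
    rfl

/-- A function on `2 k` positions, read as a function on the `k` consecutive pairs of positions. -/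
def pairsEquiv (k : ℕ) (α : Type*) : (Fin (2 * k) → α) ≃ (Fin k → α × α) where
  toFun h s := (h ⟨2 * s, by omega⟩, h ⟨2 * s + 1, by omega⟩)
  invFun g a := if (a : ℕ) % 2 = 0 then (g ⟨a / 2, by omega⟩).1 else (g ⟨a / 2, by omega⟩).2
  left_inv h := by
    funext a
    dsimp only
    split_ifs with ha
    · congr 1; ext; simp only; omega
    · congr 1; ext; simp only; omega
  right_inv g := by
    funext s
    have h1 : (2 * (s : ℕ)) % 2 = 0 := by omega
    have h2 : ¬ (2 * (s : ℕ) + 1) % 2 = 0 := by omega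
    have h3 : (2 * (s : ℕ)) / 2 = s := by omega
    have h4 : (2 * (s : ℕ) + 1) / 2 = s := by omega
    simp only [h1, h2, h3, h4, if_true, if_false]

/-- Conjugating `A` by `V` acts on the tensor `entryMonomial A` by `V` at all positions. -/
theorem entryMonomial_conj {N k : ℕ} (V A : Matrix (Fin N) (Fin N) ℝ) (f : Fin (2 * k) → Fin N) :
    entryMonomial (V * A * V.transpose) f =
      ∑ g : Fin (2 * k) → Fin N, (∏ a, V (f a) (g a)) * entryMonomial A g := by
  classical
  have h := Finset.prod_univ_sum (fun _ : Fin k => (Finset.univ : Finset (Fin N × Fin N)))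
    (fun s x => V (f ⟨2 * s, by omega⟩) x.1 * V (f ⟨2 * s + 1, by omega⟩) x.2 * A x.1 x.2)
  rw [Fintype.piFinset_univ, ← (pairsEquiv k (Fin N)).sum_comp] at h
  calc _ = ∏ s : Fin k, ∑ x : Fin N × Fin N,
        V (f ⟨2 * s, by omega⟩) x.1 * V (f ⟨2 * s + 1, by omega⟩) x.2 * A x.1 x.2 := by
        refine Finset.prod_congr rfl fun s _ => ?_
        simp only [Matrix.mul_apply, Matrix.transpose_apply, Finset.sum_mul]
        rw [Fintype.sum_prod_type, Finset.sum_comm]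
        exact Finset.sum_congr rfl fun x _ => Finset.sum_congr rfl fun y _ => by ring
    _ = _ := by
        rw [h]
        refine Finset.sum_congr rfl fun g _ => ?_
        rw [prod_fin_two_mul, entryMonomial, ← Finset.prod_mul_distrib]
        rfl

theorem continuous_entryMonomial {N k : ℕ} (f : Fin (2 * k) → Fin N) :
    Continuous fun A : Matrix (Fin N) (Fin N) ℝ => entryMonomial A f :=
  continuous_finsetProd _ fun _ _ => continuous_id.matrix_elem _ _

/-- The orthogonal projection obtained by conjugating `I_{M,N}` with `U`. -/
def conjProj (M N : ℕ) (U : O N) : Matrix (Fin N) (Fin N) ℝ :=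
  (U : Matrix (Fin N) (Fin N) ℝ) * projMatrix M N * (U : Matrix (Fin N) (Fin N) ℝ).transpose

theorem continuous_conjProj (M N : ℕ) : Continuous (conjProj M N) := by
  unfold conjProj
  fun_prop

theorem conjProj_mul (M N : ℕ) (V U : O N) : conjProj M N (V * U) =
    (V : Matrix (Fin N) (Fin N) ℝ) * conjProj M N U *
      (V : Matrix (Fin N) (Fin N) ℝ).transpose := by
  simp [conjProj, Matrix.transpose_mul, Matrix.mul_assoc]

instance (N : ℕ) : (haarO N).IsMulLeftInvariant := by unfold haarO; infer_instance

instance (N : ℕ) : IsProbabilityMeasure (haarO N) := ⟨by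
  rw [haarO, ← TopologicalSpace.PositiveCompacts.coe_top]
  exact Measure.haarMeasure_self⟩

theorem integrable_of_continuous {N : ℕ} {F : O N → ℝ} (hF : Continuous F) :
    Integrable F (haarO N) :=
  hF.integrable_of_hasCompactSupport (HasCompactSupport.of_compactSpace F)

theorem monomialIntegral_eq {M N : ℕ} (h : M < N) {k : ℕ} (f : Fin (2 * k) → Fin N) :
    monomialIntegral h f = ∫ U, entryMonomial (conjProj M N U) f ∂(haarO N) := by
  rw [monomialIntegral, haarGr, integral_map (continuous_orbitMap h).measurable.aemeasurable]
  · rfl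
  · exact ((continuous_entryMonomial f).comp
      continuous_subtype_val).measurable.aestronglyMeasurable

theorem integrable_entryMonomial (M N : ℕ) {k : ℕ} (f : Fin (2 * k) → Fin N) :
    Integrable (fun U => entryMonomial (conjProj M N U) f) (haarO N) :=
  integrable_of_continuous ((continuous_entryMonomial f).comp (continuous_conjProj M N))

theorem isInvariant_monomialIntegral {M N : ℕ} (h : M < N) (k : ℕ) :
    IsInvariant fun f : Fin (2 * k) → Fin N => monomialIntegral h f := by
  intro V f
  simp only [monomialIntegral_eq, ← integral_const_mul]
  rw [← integral_finsetSum _ fun g _ => (integrable_entryMonomial M N g).const_mul _,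
    ← integral_mul_left_eq_self (fun U => entryMonomial (conjProj M N U) f) V]
  simp only [conjProj_mul, ← entryMonomial_conj]

/-- Since the tensor of `m` is invariant, its pairing with `entryMonomial A` does not change when
`A` is conjugated by an orthogonal matrix. -/
theorem sum_pairTensor_mul_entryMonomial {N k : ℕ} (m : PairPartition k) (U : O N)
    (A : Matrix (Fin N) (Fin N) ℝ) :
    ∑ f : Fin (2 * k) → Fin N, pairTensor m f * entryMonomial
      ((U : Matrix (Fin N) (Fin N) ℝ) * A * (U : Matrix (Fin N) (Fin N) ℝ).transpose) f =
    ∑ f : Fin (2 * k) → Fin N, pairTensor m f * entryMonomial A f := by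
  simp only [entryMonomial_conj, Finset.mul_sum]
  rw [Finset.sum_comm]
  refine Finset.sum_congr rfl fun g _ => ?_
  rw [← isInvariant_pairTensor m (U⁻¹) g, Finset.sum_mul]
  refine Finset.sum_congr rfl fun f _ => ?_
  have : ∀ i j, ((U⁻¹ : O N) : Matrix (Fin N) (Fin N) ℝ) i j =
      (U : Matrix (Fin N) (Fin N) ℝ) j i := fun i j => rfl
  simp only [this]
  ring

open Classical in
theorem entryMonomial_projMatrix {M N k : ℕ} (f : Fin (2 * k) → Fin N) :
    entryMonomial (projMatrix M N) f =
      if (∀ s : Fin k, f ⟨2 * s, by omega⟩ = f ⟨2 * s + 1, by omega⟩) ∧ ∀ a, (f a : ℕ) < M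
      then 1 else 0 := by
  have : ∀ i j : Fin N, projMatrix M N i j =
      if i = j ∧ (i : ℕ) < M ∧ (j : ℕ) < M then 1 else 0 := by
    intro i j
    rw [projMatrix, Matrix.diagonal_apply]
    by_cases hij : i = j
    · subst hij; simp
    · simp [hij]
  simp only [entryMonomial, this, Finset.prod_boole]
  congr 1
  refine propext ⟨fun h => ⟨fun s => (h s (Finset.mem_univ s)).1, fun a => ?_⟩,
    fun h s _ => ⟨h.1 s, h.2 _, h.2 _⟩⟩
  have h' := (h ⟨a / 2, by omega⟩ (Finset.mem_univ _)).2
  rcases Nat.mod_two_eq_zero_or_one a with h0 | h1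
  · convert h'.1; simp only; omega
  · convert h'.2; simp only; omega

/-- Pairing the averaged monomials with the tensor of a pair partition gives a power of `M`. -/
theorem exists_sum_pairTensor_mul_monomialIntegral {k : ℕ} (m : PairPartition k) :
    ∃ e : ℕ, ∀ (M N : ℕ) (h : M < N),
      ∑ f : Fin (2 * k) → Fin N, pairTensor m f * monomialIntegral h f = (M : ℝ) ^ e := by
  classical
  let r : Fin (2 * k) → Fin (2 * k) → Prop := fun a b =>
    (∃ p ∈ m.pairs, a ∈ p ∧ b ∈ p) ∨ ∃ s : Fin k, (a : ℕ) = 2 * s ∧ (b : ℕ) = 2 * s + 1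
  refine ⟨Nat.card (Quot r), fun M N h => ?_⟩
  have hS : (Finset.univ.filter fun i : Fin N => (i : ℕ) < M).card = M := by
    rw [Fin.card_filter_val_lt]; omega
  have key := sum_respecting r (Finset.univ.filter fun i : Fin N => (i : ℕ) < M)
  rw [hS] at key
  rw [← key]
  simp only [monomialIntegral_eq, ← integral_const_mul]
  rw [← integral_finsetSum _ fun g _ => (integrable_entryMonomial M N g).const_mul _]
  simp only [conjProj, sum_pairTensor_mul_entryMonomial]
  rw [integral_const, probReal_univ, one_smul]
  refine Finset.sum_congr rfl fun f _ => ?_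
  rw [pairTensor, entryMonomial_projMatrix, ite_zero_mul_ite_zero, mul_one]
  congr 1
  simp only [Finset.mem_filter, Finset.mem_univ, true_and, ← and_assoc]
  refine propext (and_congr_left fun _ => ⟨?_, fun hr => ⟨?_, ?_⟩⟩)
  · rintro ⟨h1, h2⟩ a b (⟨p, hp, ha, hb⟩ | ⟨s, ha, hb⟩)
    · exact h1 p hp a ha b hb
    · convert h2 s
  · exact fun p hp a ha b hb => hr a b (Or.inl ⟨p, hp, ha, hb⟩)
  · exact fun s => hr _ _ (Or.inr ⟨s, rfl, rfl⟩)

/-- The entries of the Gram matrix of the pair partition tensors are powers of `N`. -/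
theorem exists_sum_pairTensor_mul_pairTensor {k : ℕ} (m n : PairPartition k) :
    ∃ e : ℕ, ∀ N : ℕ,
      ∑ f : Fin (2 * k) → Fin N, pairTensor m f * pairTensor n f = (N : ℝ) ^ e := by
  classical
  let r : Fin (2 * k) → Fin (2 * k) → Prop := fun a b =>
    (∃ p ∈ m.pairs, a ∈ p ∧ b ∈ p) ∨ ∃ p ∈ n.pairs, a ∈ p ∧ b ∈ p
  refine ⟨Nat.card (Quot r), fun N => ?_⟩
  have key := sum_respecting r (Finset.univ : Finset (Fin N))
  rw [Finset.card_univ, Fintype.card_fin] at key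
  rw [← key]
  refine Finset.sum_congr rfl fun f _ => ?_
  rw [pairTensor, pairTensor, ite_zero_mul_ite_zero, mul_one]
  congr 1
  simp only [Finset.mem_univ, implies_true, and_true]
  refine propext ⟨?_, fun hr => ⟨?_, ?_⟩⟩
  · rintro ⟨h1, h2⟩ a b (⟨p, hp, ha, hb⟩ | ⟨p, hp, ha, hb⟩)
    · exact h1 p hp a ha b hb
    · exact h2 p hp a ha b hb
  · exact fun p hp a ha b hb => hr a b (Or.inl ⟨p, hp, ha, hb⟩)
  · exact fun p hp a ha b hb => hr a b (Or.inr ⟨p, hp, ha, hb⟩)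

/-! ### Values of rational functions -/

namespace HasValueAt

variable {x y r s : ℝ} {W W' : RatMN}

theorem algebraMap_ne_zero {q : MvPolynomial (Fin 2) ℝ} (hq : MvPolynomial.eval ![x, y] q ≠ 0) :
    algebraMap _ RatMN q ≠ 0 := by
  rw [Ne, FaithfulSMul.algebraMap_eq_zero_iff]
  rintro rfl
  simp at hq

theorem of_polynomial (p : MvPolynomial (Fin 2) ℝ) :
    HasValueAt (algebraMap _ RatMN p) x y (MvPolynomial.eval ![x, y] p) :=
  ⟨p, 1, by simp, by simp, by simp⟩

theorem varM : HasValueAt varM x y x := by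
  simpa [GrassmannWeingarten.varM] using of_polynomial (x := x) (y := y) (MvPolynomial.X 0)

theorem varN : HasValueAt varN x y y := by
  simpa [GrassmannWeingarten.varN] using of_polynomial (x := x) (y := y) (MvPolynomial.X 1)

theorem zero : HasValueAt 0 x y 0 := by
  simpa using of_polynomial (x := x) (y := y) 0

theorem one : HasValueAt 1 x y 1 := by
  simpa using of_polynomial (x := x) (y := y) 1

theorem add (h : HasValueAt W x y r) (h' : HasValueAt W' x y s) :
    HasValueAt (W + W') x y (r + s) := by
  obtain ⟨p, q, hq, rfl, rfl⟩ := h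
  obtain ⟨p', q', hq', rfl, rfl⟩ := h'
  refine ⟨p * q' + q * p', q * q', by simpa using ⟨hq, hq'⟩, ?_, ?_⟩
  · rw [div_add_div _ _ (algebraMap_ne_zero hq) (algebraMap_ne_zero hq')]
    simp
  · rw [div_add_div _ _ hq hq']
    simp

theorem mul (h : HasValueAt W x y r) (h' : HasValueAt W' x y s) :
    HasValueAt (W * W') x y (r * s) := by
  obtain ⟨p, q, hq, rfl, rfl⟩ := h
  obtain ⟨p', q', hq', rfl, rfl⟩ := h'
  refine ⟨p * p', q * q', by simpa using ⟨hq, hq'⟩, ?_, ?_⟩ <;> simp [div_mul_div_comm]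

theorem neg (h : HasValueAt W x y r) : HasValueAt (-W) x y (-r) := by
  obtain ⟨p, q, hq, rfl, rfl⟩ := h
  exact ⟨-p, q, hq, by simp [neg_div], by simp [neg_div]⟩

theorem inv (h : HasValueAt W x y r) (hr : r ≠ 0) : HasValueAt W⁻¹ x y r⁻¹ := by
  obtain ⟨p, q, hq, rfl, rfl⟩ := h
  exact ⟨q, p, fun hp => hr (by simp [hp]), by rw [inv_div], by rw [inv_div]⟩

theorem div (h : HasValueAt W x y r) (h' : HasValueAt W' x y s) (hs : s ≠ 0) :
    HasValueAt (W / W') x y (r / s) := by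
  rw [div_eq_mul_inv, div_eq_mul_inv]
  exact h.mul (h'.inv hs)

theorem sum {κ : Type*} (t : Finset κ) {W : κ → RatMN} {r : κ → ℝ}
    (h : ∀ i, HasValueAt (W i) x y (r i)) : HasValueAt (∑ i ∈ t, W i) x y (∑ i ∈ t, r i) := by
  classical
  induction t using Finset.induction_on with
  | empty => simpa using zero
  | insert i t hi ih => rw [Finset.sum_insert hi, Finset.sum_insert hi]; exact (h i).add ih

theorem eval_mul_eq {p q : MvPolynomial (Fin 2) ℝ} (hq : q ≠ 0)
    (h : HasValueAt (algebraMap _ RatMN p / algebraMap _ RatMN q) x y r) :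
    r * MvPolynomial.eval ![x, y] q = MvPolynomial.eval ![x, y] p := by
  obtain ⟨p', q', hq', e, rfl⟩ := h
  have hq0 : algebraMap _ RatMN q ≠ 0 := by rwa [Ne, FaithfulSMul.algebraMap_eq_zero_iff]
  rw [div_eq_div_iff hq0 (algebraMap_ne_zero hq'), ← map_mul, ← map_mul] at e
  have e' := congrArg (MvPolynomial.eval ![x, y])
    (FaithfulSMul.algebraMap_injective (MvPolynomial (Fin 2) ℝ) RatMN e)
  rw [map_mul, map_mul] at e'
  rw [div_mul_eq_mul_div, div_eq_iff hq', e']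

end HasValueAt

/-- A polynomial in two variables that vanishes at all integer points `(M, N)` with `M < N` and
`K ≤ N` is zero. -/
theorem eq_zero_of_eval_eq_zero {P : MvPolynomial (Fin 2) ℝ} (K : ℕ)
    (h : ∀ M N : ℕ, M < N → K ≤ N → MvPolynomial.eval ![(M : ℝ), (N : ℝ)] P = 0) : P = 0 := by
  classical
  -- A grid `[0, d) × [d + K, 2d + K)` that is larger than the degrees lies in the region `M < N`.
  let d := max (P.degreeOf 0) (P.degreeOf 1) + 1
  let S : Fin 2 → Finset ℝ := ![(Finset.range d).image (fun i : ℕ => (i : ℝ)),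
    (Finset.range d).image (fun i : ℕ => ((i + d + K : ℕ) : ℝ))]
  refine MvPolynomial.eq_zero_of_eval_zero_at_prod_finset P S ?_ ?_
  · have h0 : (S 0).card = d := by
      simp only [S, Matrix.cons_val_zero]
      rw [Finset.card_image_of_injective _ Nat.cast_injective, Finset.card_range]
    have h1 : (S 1).card = d := by
      simp only [S, Matrix.cons_val_one, Matrix.cons_val_zero]
      rw [Finset.card_image_of_injective, Finset.card_range]
      intro a b hab
      have := Nat.cast_injective hab
      omega
    intro i
    fin_cases i
    · change _ < (S 0).card; rw [h0]; exact Nat.lt_succ_of_le (le_max_left _ _)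
    · change _ < (S 1).card; rw [h1]; exact Nat.lt_succ_of_le (le_max_right _ _)
  · intro x hx
    obtain ⟨a, ha, hxa⟩ := Finset.mem_image.1 (hx 0)
    obtain ⟨b, hb, hxb⟩ := Finset.mem_image.1 (hx 1)
    rw [Finset.mem_range] at ha hb
    have : x = ![(a : ℝ), ((b + d + K : ℕ) : ℝ)] := by
      ext i
      fin_cases i
      · exact hxa.symm
      · exact hxb.symm
    rw [this]
    exact h _ _ (by omega) (by omega)

/-- A rational function is determined by its values at the integer points `(M, N)` with `M < N` and
`K ≤ N`. -/
theorem eq_of_hasValueAt {W W' : RatMN} (K : ℕ)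
    (h : ∀ M N : ℕ, M < N → K ≤ N → ∃ r, HasValueAt W M N r ∧ HasValueAt W' M N r) : W = W' := by
  obtain ⟨p, q, hq, rfl⟩ := IsFractionRing.div_surjective (A := MvPolynomial (Fin 2) ℝ) W
  obtain ⟨p', q', hq', rfl⟩ := IsFractionRing.div_surjective (A := MvPolynomial (Fin 2) ℝ) W'
  have hq := nonZeroDivisors.ne_zero hq
  have hq' := nonZeroDivisors.ne_zero hq'
  rw [div_eq_div_iff (by rwa [Ne, FaithfulSMul.algebraMap_eq_zero_iff])
    (by rwa [Ne, FaithfulSMul.algebraMap_eq_zero_iff]), ← map_mul, ← map_mul]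
  congr 1
  refine sub_eq_zero.1 (eq_zero_of_eval_eq_zero K fun M N hMN hK => ?_)
  obtain ⟨r, h1, h2⟩ := h M N hMN hK
  rw [map_sub, map_mul, map_mul, ← h1.eval_mul_eq hq, ← h2.eval_mul_eq hq']
  ring

/-! ### Existence and uniqueness of the Weingarten function -/

theorem monomialIntegral_eq_of_stronglyAdmissible {M N : ℕ} (h : M < N) {k : ℕ}
    {m : PairPartition k} {f g : Fin (2 * k) → Fin N} (hf : StronglyAdmissible m f)
    (hg : StronglyAdmissible m g) : monomialIntegral h f = monomialIntegral h g := by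
  obtain ⟨σ, rfl⟩ := hf.exists_perm hg
  exact ((isInvariant_monomialIntegral h k).perm σ f).symm

open Classical in
/-- In the stable range the tensors of the pair partitions are linearly independent, so that their
Gram matrix is nonsingular. -/
theorem det_gram_ne_zero {k N : ℕ} (hkN : k ≤ N) :
    (Matrix.of fun m n : PairPartition k =>
      ∑ f : Fin (2 * k) → Fin N, pairTensor m f * pairTensor n f).det ≠ 0 := by
  intro h
  obtain ⟨c, hc, hc'⟩ := Matrix.exists_mulVec_eq_zero_iff.2 h
  -- A null vector of a Gram matrix gives a vanishing combination of the tensors.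
  have hsq : ∑ f : Fin (2 * k) → Fin N, (∑ m, c m * pairTensor m f) ^ 2 = 0 := by
    have := congrArg (c ⬝ᵥ ·) hc'
    simp only [dotProduct_zero] at this
    rw [← this]
    simp only [dotProduct, Matrix.mulVec, Matrix.of_apply, sq, Finset.mul_sum,
      Finset.sum_mul]
    rw [Finset.sum_comm]
    refine Finset.sum_congr rfl fun m _ => ?_
    rw [Finset.sum_comm]
    refine Finset.sum_congr rfl fun n _ => Finset.sum_congr rfl fun f _ => ?_
    ring
  refine hc (funext fun m => ?_)
  obtain ⟨f, hf⟩ := exists_stronglyAdmissible m hkN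
  have := (Finset.sum_eq_zero_iff_of_nonneg fun f _ => sq_nonneg _).1 hsq f (Finset.mem_univ f)
  simpa [hf.pairTensor_eq] using this

/-- The averaged monomials at strongly admissible index functions solve a linear system, whose
matrix is the Gram matrix of the pair partition tensors and whose entries are polynomials in `M` and
`N`; Cramer's rule gives the rational function. -/
theorem exists_isWeingartenValue {k : ℕ} (m : PairPartition k) :
    ∃ W, IsWeingartenValue m W := by
  classical
  choose e he using fun m n : PairPartition k => exists_sum_pairTensor_mul_pairTensor m n
  choose d hd using fun m : PairPartition k => exists_sum_pairTensor_mul_monomialIntegral m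
  let G : Matrix (PairPartition k) (PairPartition k) (MvPolynomial (Fin 2) ℝ) :=
    Matrix.of fun m n => MvPolynomial.X 1 ^ e m n
  let b : PairPartition k → MvPolynomial (Fin 2) ℝ := fun m => MvPolynomial.X 0 ^ d m
  refine ⟨algebraMap _ RatMN ((G.adjugate.mulVec b) m) / algebraMap _ RatMN G.det,
    fun M N h hkN f hf => ?_⟩
  choose F hF using fun m : PairPartition k => exists_stronglyAdmissible m hkN
  let ev : MvPolynomial (Fin 2) ℝ →+* ℝ := MvPolynomial.eval ![(M : ℝ), (N : ℝ)]
  have hG : ev.mapMatrix G = Matrix.of fun m n : PairPartition k =>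
      ∑ f : Fin (2 * k) → Fin N, pairTensor m f * pairTensor n f := by
    ext m n
    simp [G, ev, he]
  have hdet : ev G.det ≠ 0 := by
    rw [RingHom.map_det, hG]
    exact det_gram_ne_zero hkN
  have hb : ∀ m, ev (b m) =
      (ev.mapMatrix G).mulVec (fun n => monomialIntegral h (F n)) m := by
    intro m
    have : ev (b m) = (M : ℝ) ^ d m := by simp [b, ev]
    rw [this, ← hd m M N h, hG]
    simp only [Matrix.mulVec, dotProduct, Matrix.of_apply, Finset.sum_mul]
    rw [Finset.sum_comm]
    refine Finset.sum_congr rfl fun g _ => ?_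
    rw [(isInvariant_monomialIntegral h k).eq_sum_pairTensor hkN hF g, Finset.mul_sum]
    exact Finset.sum_congr rfl fun n _ => by ring
  refine ⟨_, _, hdet, rfl, ?_⟩
  rw [eq_div_iff hdet, monomialIntegral_eq_of_stronglyAdmissible h hf (hF m)]
  change _ = ev _
  have hb' : ev ∘ b = (ev.mapMatrix G).mulVec fun n => monomialIntegral h (F n) := funext hb
  rw [RingHom.map_mulVec, hb', ← RingHom.mapMatrix_apply, RingHom.map_adjugate,
    Matrix.mulVec_mulVec, Matrix.adjugate_mul, Matrix.smul_mulVec, Matrix.one_mulVec,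
    RingHom.map_det, Pi.smul_apply, smul_eq_mul, mul_comm]

theorem eq_of_isWeingartenValue {k : ℕ} {m : PairPartition k} {W W' : RatMN}
    (h : IsWeingartenValue m W) (h' : IsWeingartenValue m W') : W = W' := by
  refine eq_of_hasValueAt k fun M N hMN hkN => ?_
  obtain ⟨f, hf⟩ := exists_stronglyAdmissible m hkN
  exact ⟨_, h M N hMN hkN f hf, h' M N hMN hkN f hf⟩

theorem isWeingartenValue_wgA {k : ℕ} (m : PairPartition k) : IsWeingartenValue m (WgA m) := by
  rw [WgA, dif_pos (exists_isWeingartenValue m)]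
  exact (exists_isWeingartenValue m).choose_spec

/-! ### Contraction of a pair of indices -/

/-- The sum over a common value of the positions `p` and `q` of an invariant tensor, for `{p, q}` a
fibre of `f`. -/
theorem IsInvariant.contract {ι : Type*} [Fintype ι] [DecidableEq ι] {N : ℕ}
    {D : (ι → Fin N) → ℝ} (hD : IsInvariant D) (f : ι → Fin N) {p q : ι} (hpq : p ≠ q)
    (hf : ∀ a, f a = f p ↔ a = p ∨ a = q) :
    ∑ l, D (Function.update (Function.update f p l) q l) + 2 * D f =
      N * D f + ∑ a, D (f ∘ Equiv.swap a p) := by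
  -- Rotate in the plane of `f p` and `l` at the index function `f` with position `p` moved to `l`:
  -- moving `q` to `l` gives the left-hand side; moving a position with value `l` back to
  -- `f p` gives `f` itself or `f` composed with a transposition.
  have key : ∀ l, l ≠ f p → D (Function.update (Function.update f p l) q l) =
      D f + ∑ a with f a = l, D (f ∘ Equiv.swap a p) := by
    intro l hl
    have e := hD.rotation hl.symm (Function.update f p l)
    have h1 : (Finset.univ.filter fun a => Function.update f p l a = f p) = {q} := by
      ext a
      by_cases ha : a = p
      · subst ha; simp [hl, hpq]
      · simp [ha, hf]
    have h2 : (Finset.univ.filter fun a => Function.update f p l a = l) =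
        insert p (Finset.univ.filter fun a => f a = l) := by
      ext a
      by_cases ha : a = p
      · subst ha; simp
      · simp [ha]
    rw [h1, h2, Finset.sum_singleton, Finset.sum_insert (by simpa using hl.symm)] at e
    rw [e, Function.update_idem, Function.update_eq_self]
    congr 1
    refine Finset.sum_congr rfl fun a ha => congrArg D (funext fun b => ?_)
    have ha := (Finset.mem_filter.1 ha).2
    have hap : a ≠ p := by rintro rfl; exact hl ha.symm
    simp only [Function.update_apply, Function.comp_apply, Equiv.swap_apply_def]
    split_ifs <;> simp_all
  have hself : Function.update (Function.update f p (f p)) q (f p) = f := by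
    rw [Function.update_eq_self, ← (hf q).2 (Or.inr rfl), Function.update_eq_self]
  have hswap : f ∘ Equiv.swap q p = f := by
    have := (hf q).2 (Or.inr rfl)
    funext b
    simp only [Function.comp_apply, Equiv.swap_apply_def]
    split_ifs with h1 h2
    · rw [h1, this]
    · rw [h2, this]
    · rfl
  have hfib : ∑ a with f a = f p, D (f ∘ Equiv.swap a p) = 2 * D f := by
    have : (Finset.univ.filter fun a => f a = f p) = {p, q} := by ext a; simp [hf]
    rw [this, Finset.sum_pair hpq, hswap, Equiv.swap_self]
    simp only [Equiv.coe_refl, Function.comp_id]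
    ring
  have hcard : ∑ l ∈ Finset.univ.erase (f p), D f = (N - 1) * D f := by
    rw [Finset.sum_const, Finset.card_erase_of_mem (Finset.mem_univ _), Finset.card_univ,
      Fintype.card_fin, nsmul_eq_mul, Nat.cast_pred (f p).pos]
  rw [← Finset.sum_fiberwise Finset.univ f, ← Finset.add_sum_erase _ _ (Finset.mem_univ (f p)),
    ← Finset.add_sum_erase _ _ (Finset.mem_univ (f p)),
    Finset.sum_congr rfl fun l hl => key l (Finset.ne_of_mem_erase hl), Finset.sum_add_distrib,
    hself, hcard, hfib]
  ring

/-- Exchanging the two indices of the last matrix entry does not change the average, because the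
matrices are symmetric. -/
theorem monomialIntegral_swap_last {M N k : ℕ} (h : M < N) (f : Fin (2 * (k + 1)) → Fin N) :
    monomialIntegral h (f ∘ Equiv.swap (ult k) (penult k)) = monomialIntegral h f := by
  rw [monomialIntegral, monomialIntegral]
  congr 1
  funext A
  rw [Fin.prod_univ_castSucc, Fin.prod_univ_castSucc]
  congr 1
  · refine Finset.prod_congr rfl fun s _ => ?_
    have hs := s.2
    simp only [Function.comp_apply]
    rw [Equiv.swap_apply_of_ne_of_ne, Equiv.swap_apply_of_ne_of_ne] <;>
      simp only [ne_eq, Fin.ext_iff, ult, penult, Fin.val_castSucc] <;> omega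
  · have h1 : f (Equiv.swap (ult k) (penult k) (penult k)) = f (ult k) := by simp
    have h2 : f (Equiv.swap (ult k) (penult k) (ult k)) = f (penult k) := by simp
    refine Eq.trans (congrArg₂ A.1 h1 h2) ?_
    exact congrFun (congrFun A.2.2.1 _) _

theorem entryMonomial_succ {N k : ℕ} (A : Matrix (Fin N) (Fin N) ℝ)
    (f : Fin (2 * (k + 1)) → Fin N) :
    entryMonomial A f = entryMonomial A (f ∘ incl k) * A (f (penult k)) (f (ult k)) :=
  Fin.prod_univ_castSucc _

theorem penult_ne_ult (k : ℕ) : penult k ≠ ult k := by simp [penult, ult, Fin.ext_iff]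

theorem incl_ne_penult {k : ℕ} (i : Fin (2 * k)) : incl k i ≠ penult k := by
  have := i.2
  simp only [ne_eq, Fin.ext_iff, incl, penult, Fin.castLEEmb_apply, Fin.val_castLE]
  omega

theorem incl_ne_ult {k : ℕ} (i : Fin (2 * k)) : incl k i ≠ ult k := by
  have := i.2
  simp only [ne_eq, Fin.ext_iff, incl, ult, Fin.castLEEmb_apply, Fin.val_castLE]
  omega

theorem trace_conjProj {M N : ℕ} (h : M < N) (U : O N) : (conjProj M N U).trace = M := by
  have hU : (U : Matrix (Fin N) (Fin N) ℝ).transpose * (U : Matrix (Fin N) (Fin N) ℝ) = 1 :=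
    (Matrix.mem_orthogonalGroup_iff' (Fin N) ℝ).1 U.2
  rw [conjProj, Matrix.mul_assoc, Matrix.trace_mul_comm, Matrix.mul_assoc, hU, Matrix.mul_one,
    projMatrix, Matrix.trace_diagonal, Finset.sum_boole, Fin.card_filter_val_lt]
  congr 1
  omega

/-- Contracting the two indices of the last entry gives the trace `M`. -/
theorem sum_monomialIntegral_last {M N k : ℕ} (h : M < N) (f : Fin (2 * (k + 1)) → Fin N) :
    ∑ l, monomialIntegral h (Function.update (Function.update f (penult k) l) (ult k) l) =
      M * monomialIntegral h (f ∘ incl k) := by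
  simp only [monomialIntegral_eq]
  rw [← integral_finsetSum _ fun l _ => integrable_entryMonomial M N _, ← integral_const_mul]
  congr 1
  funext U
  have h0 : ∀ l, Function.update (Function.update f (penult k) l) (ult k) l ∘ incl k =
      f ∘ incl k := by
    intro l
    funext i
    simp [incl_ne_ult, incl_ne_penult]
  simp only [entryMonomial_succ, h0, Function.update_self,
    Function.update_of_ne (penult_ne_ult k)]
  rw [← Finset.mul_sum, mul_comm, ← trace_conjProj h U]
  rfl

/-- Contracting an index of another entry with the first index of the last entry multiplies the two
entries as matrices, and the matrices are idempotent. -/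
theorem sum_entryMonomial_eq {N k : ℕ} {A : Matrix (Fin N) (Fin N) ℝ} (hA : A * A = A)
    (hA' : A.transpose = A) (f : Fin (2 * k) → Fin N) (j : Fin (2 * k)) (v : Fin N) :
    ∑ l, entryMonomial A (Function.update f j l) * A l v =
      entryMonomial A (Function.update f j v) := by
  have hs : ∀ x y, A x y = A y x := fun x y => congrFun (congrFun hA' y) x
  have hi : ∀ x y, ∑ l, A x l * A l y = A x y := fun x y => by
    rw [← Matrix.mul_apply, hA]
  let s : Fin k := ⟨j / 2, by omega⟩
  have hfac : ∀ l, entryMonomial A (Function.update f j l) =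
      A (Function.update f j l ⟨2 * s, by omega⟩) (Function.update f j l ⟨2 * s + 1, by omega⟩) *
        ∏ t ∈ Finset.univ.erase s, A (f ⟨2 * t, by omega⟩) (f ⟨2 * t + 1, by omega⟩) := by
    intro l
    rw [entryMonomial, ← Finset.mul_prod_erase _ _ (Finset.mem_univ s)]
    congr 1
    refine Finset.prod_congr rfl fun t ht => ?_
    have ht : (t : ℕ) ≠ j / 2 := fun e => Finset.ne_of_mem_erase ht (Fin.ext e)
    rw [Function.update_of_ne, Function.update_of_ne] <;>
      simp only [ne_eq, Fin.ext_iff] <;> omega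
  simp only [hfac, mul_right_comm]
  rw [← Finset.sum_mul]
  congr 1
  rcases Nat.mod_two_eq_zero_or_one j with h0 | h1
  · have e1 : (⟨2 * s, by omega⟩ : Fin (2 * k)) = j := Fin.ext (by simp only [s]; omega)
    have e2 : (⟨2 * s + 1, by omega⟩ : Fin (2 * k)) ≠ j := by
      simp only [ne_eq, Fin.ext_iff, s]; omega
    simp only [e1, Function.update_self, Function.update_of_ne e2]
    simp only [hs _ (f _), hi]
  · have e1 : (⟨2 * s + 1, by omega⟩ : Fin (2 * k)) = j := Fin.ext (by simp only [s]; omega)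
    have e2 : (⟨2 * s, by omega⟩ : Fin (2 * k)) ≠ j := by
      simp only [ne_eq, Fin.ext_iff, s]; omega
    simp only [e1, Function.update_self, Function.update_of_ne e2, hi]

theorem sum_monomialIntegral_incl {M N k : ℕ} (h : M < N) (f : Fin (2 * (k + 1)) → Fin N)
    (j : Fin (2 * k)) :
    ∑ l, monomialIntegral h (Function.update (Function.update f (penult k) l) (incl k j) l) =
      monomialIntegral h (Function.update (f ∘ incl k) j (f (ult k))) := by
  simp only [monomialIntegral_eq]
  rw [← integral_finsetSum _ fun l _ => integrable_entryMonomial M N _]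
  congr 1
  funext U
  obtain ⟨h1, h2, -⟩ := conj_mem_grassmannian h U
  rw [conjProj, ← sum_entryMonomial_eq h1 h2]
  refine Finset.sum_congr rfl fun l _ => ?_
  rw [entryMonomial_succ, Function.update_comp_eq_of_injective _ (incl k).injective,
    Function.update_comp_eq_of_notMem_range, Function.update_of_ne (incl_ne_penult j).symm,
    Function.update_of_ne (incl_ne_ult j).symm, Function.update_self,
    Function.update_of_ne (penult_ne_ult k).symm]
  rintro ⟨i, hi⟩
  exact incl_ne_penult i hi

/-! ### The orthogonality relations -/

theorem StronglyAdmissible.comp_swap {k N : ℕ} {m : PairPartition k} {f : Fin (2 * k) → Fin N}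
    (hf : StronglyAdmissible m f) (i j : Fin (2 * k)) :
    StronglyAdmissible (Equiv.swap i j • m) (f ∘ Equiv.swap i j) := by
  intro a b hab
  rw [PairPartition.pair_mem_smul_iff, Equiv.symm_swap]
  exact hf _ _ ((Equiv.swap i j).injective.ne hab)

theorem StronglyAdmissible.down {k N : ℕ} {m : PairPartition (k + 1)}
    {f : Fin (2 * (k + 1)) → Fin N} (hf : StronglyAdmissible m f)
    (h : {penult k, ult k} ∈ m.pairs) : StronglyAdmissible (m.down h) (f ∘ incl k) := by
  intro a b hab
  rw [PairPartition.pair_mem_down_iff]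
  exact hf _ _ ((incl k).injective.ne hab)

theorem StronglyAdmissible.eq_iff_of_pair_mem {k N : ℕ} {m : PairPartition k}
    {f : Fin (2 * k) → Fin N} (hf : StronglyAdmissible m f) {p q : Fin (2 * k)}
    (hpq : {p, q} ∈ m.pairs) (a : Fin (2 * k)) : f a = f p ↔ a = p ∨ a = q := by
  by_cases hap : a = p
  · simp [hap]
  · rw [← hf a p hap, Finset.pair_comm]
    simp only [hap, false_or]
    exact ⟨fun h => m.eq_of_pair_mem h hpq, by rintro rfl; exact hpq⟩

/-- The sum over a common value of the position `2k-1` and its partner `q`, in terms of the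
transpositions `(i 2k-1)` with `i ≤ 2k-2`. -/
theorem sum_monomialIntegral_update {M N k : ℕ} (h : M < N) {m : PairPartition (k + 1)}
    {f : Fin (2 * (k + 1)) → Fin N} (hf : StronglyAdmissible m f) {q : Fin (2 * (k + 1))}
    (hq : {penult k, q} ∈ m.pairs) :
    ∑ l, monomialIntegral h (Function.update (Function.update f (penult k) l) q l) =
      N * monomialIntegral h f +
        ∑ i, monomialIntegral h (f ∘ Equiv.swap (incl k i) (penult k)) := by
  have e := (isInvariant_monomialIntegral h (k + 1)).contract f (m.ne_of_pair_mem hq)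
    (hf.eq_iff_of_pair_mem hq)
  rw [sum_univ_penult_ult, monomialIntegral_swap_last, Equiv.swap_self] at e
  simp only [Equiv.coe_refl, Function.comp_id] at e
  linarith

/-- The orthogonality relation for the averaged monomials themselves. -/
theorem monomialIntegral_relation {M N k : ℕ} (h : M < N) {m : PairPartition (k + 1)}
    {f : Fin (2 * (k + 1)) → Fin N} (hf : StronglyAdmissible m f) :
    N * monomialIntegral h f +
        ∑ i, monomialIntegral h (f ∘ Equiv.swap (incl k i) (penult k)) =
      M * (if {penult k, ult k} ∈ m.pairs then monomialIntegral h (f ∘ incl k) else 0) +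
        ∑ i, if {incl k i, ult k} ∈ m.pairs then
          monomialIntegral h (f ∘ Equiv.swap (incl k i) (penult k) ∘ incl k) else 0 := by
  obtain ⟨q, hq⟩ := m.exists_pair_mem (penult k)
  rw [← sum_monomialIntegral_update h hf hq]
  by_cases hqu : q = ult k
  · subst hqu
    rw [sum_monomialIntegral_last, if_pos hq, Finset.sum_eq_zero, add_zero]
    intro i _
    refine if_neg fun hi => ?_
    rw [Finset.pair_comm] at hi hq
    exact incl_ne_penult i (m.eq_of_pair_mem hi hq)
  · have hlt : (q : ℕ) < 2 * k := by
      have h1 := (m.ne_of_pair_mem hq).symm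
      have h2 := q.2
      simp only [ne_eq, Fin.ext_iff, penult, ult] at h1 hqu
      omega
    obtain ⟨j, rfl⟩ : ∃ j, q = incl k j := ⟨⟨q, hlt⟩, rfl⟩
    obtain ⟨i', hi'⟩ := m.exists_pair_mem (ult k)
    have hi'p : i' ≠ penult k := by
      rintro rfl
      rw [Finset.pair_comm] at hi'
      exact hqu (m.eq_of_pair_mem hq hi')
    have hlt' : (i' : ℕ) < 2 * k := by
      have h1 := (m.ne_of_pair_mem hi').symm
      have h2 := i'.2
      simp only [ne_eq, Fin.ext_iff, penult, ult] at h1 hi'p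
      omega
    obtain ⟨i, rfl⟩ : ∃ i, i' = incl k i := ⟨⟨i', hlt'⟩, rfl⟩
    have hiu : ∀ x, {incl k x, ult k} ∈ m.pairs ↔ x = i := by
      intro x
      rw [Finset.pair_comm]
      exact ⟨fun hx => (incl k).injective (m.eq_of_pair_mem hx hi'), by rintro rfl; exact hi'⟩
    have hpu : {penult k, ult k} ∉ m.pairs := fun hpu => hqu (m.eq_of_pair_mem hq hpu)
    have hij : i ≠ j := by
      rintro rfl
      rw [Finset.pair_comm] at hq hi'
      exact penult_ne_ult k (m.eq_of_pair_mem hq hi')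
    rw [sum_monomialIntegral_incl, if_neg hpu, mul_zero, zero_add]
    simp only [hiu]
    rw [Finset.sum_ite_eq' Finset.univ i, if_pos (Finset.mem_univ i)]
    -- The two index functions differ by the exchange of the values `f i` and `f j`.
    rw [← (isInvariant_monomialIntegral h k).perm (Equiv.swap (f (ult k)) (f (penult k)))]
    congr 1
    funext x
    have h1 := hf.eq_iff_of_pair_mem hq (incl k x)
    have h2 := hf.eq_iff_of_pair_mem hi' (incl k x)
    have h3 := (hf.eq_iff_of_pair_mem hq (incl k j)).2 (Or.inr rfl)
    simp only [incl_ne_penult, incl_ne_ult, false_or, (incl k).injective.eq_iff] at h1 h2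
    simp only [Function.comp_apply]
    by_cases hxj : x = j
    · subst hxj
      rw [Function.update_self, Equiv.swap_apply_left,
        Equiv.swap_apply_of_ne_of_ne ((incl k).injective.ne hij.symm) (incl_ne_penult x), h3]
    · rw [Function.update_of_ne hxj]
      by_cases hxi : x = i
      · subst hxi
        simp only [Function.comp_apply]
        rw [h2.2 rfl, Equiv.swap_apply_left, Equiv.swap_apply_left]
      · rw [Function.comp_apply, Equiv.swap_apply_of_ne_of_ne (mt h2.1 hxi) (mt h1.1 hxj),
          Equiv.swap_apply_of_ne_of_ne ((incl k).injective.ne hxi) (incl_ne_penult x)]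

theorem wgA_relation (k : ℕ) (m : PairPartition (k + 1)) :
    WgA m =
      -(1 / varN) * ∑ i : Fin (2 * k), WgA (Equiv.swap (incl k i) (penult k) • m)
      + varM / varN * (if h : {penult k, ult k} ∈ m.pairs then WgA (m.down h) else 0)
      + 1 / varN * ∑ i : Fin (2 * k),
          (if h : {incl k i, ult k} ∈ m.pairs then
            WgA ((Equiv.swap (incl k i) (penult k) • m).down (last_pair_mem_swap_smul h))
          else 0) := by
  refine eq_of_hasValueAt (k + 1) fun M N hMN hkN => ?_
  obtain ⟨f, hf⟩ := exists_stronglyAdmissible m hkN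
  refine ⟨_, isWeingartenValue_wgA m M N hMN hkN f hf, ?_⟩
  have hN : (N : ℝ) ≠ 0 := Nat.cast_ne_zero.2 (by omega)
  have hinv : HasValueAt (1 / varN) M N (1 / N) := HasValueAt.one.div HasValueAt.varN hN
  have h1 : HasValueAt (∑ i : Fin (2 * k), WgA (Equiv.swap (incl k i) (penult k) • m)) M N
      (∑ i, monomialIntegral hMN (f ∘ Equiv.swap (incl k i) (penult k))) :=
    HasValueAt.sum _ fun i => isWeingartenValue_wgA _ M N hMN hkN _ (hf.comp_swap _ _)
  have h2 : HasValueAt (if h : {penult k, ult k} ∈ m.pairs then WgA (m.down h) else 0) M N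
      (if {penult k, ult k} ∈ m.pairs then monomialIntegral hMN (f ∘ incl k) else 0) := by
    split_ifs with h
    · exact isWeingartenValue_wgA _ M N hMN (by omega) _ (hf.down h)
    · exact HasValueAt.zero
  have h3 : HasValueAt (∑ i : Fin (2 * k), (if h : {incl k i, ult k} ∈ m.pairs then
      WgA ((Equiv.swap (incl k i) (penult k) • m).down (last_pair_mem_swap_smul h)) else 0)) M N
      (∑ i, if {incl k i, ult k} ∈ m.pairs then
          monomialIntegral hMN (f ∘ Equiv.swap (incl k i) (penult k) ∘ incl k) else 0) := by
    refine HasValueAt.sum _ fun i => ?_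
    split_ifs with h
    · exact isWeingartenValue_wgA _ M N hMN (by omega) _
        ((hf.comp_swap _ _).down (last_pair_mem_swap_smul h))
    · exact HasValueAt.zero
  convert ((hinv.neg.mul h1).add ((HasValueAt.varM.div HasValueAt.varN hN).mul h2)).add
    (hinv.mul h3) using 1
  have e := monomialIntegral_relation hMN hf
  field_simp
  linarith

end GrassmannWeingarten

open GrassmannWeingarten in
/-- First part: the Weingarten function is well defined, that is, for each pair partition `m` there
is exactly one rational function in `(M, N)` that takes the value of the defining integral for all
`M < N` with `k ≤ N` and all strongly admissible functions, and it is `WgA m`.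
Second part: the orthogonality relations, for each non-empty pair partition. -/
theorem theorem3p4 :
    (∀ (k : ℕ) (m : PairPartition k) (W : RatMN), IsWeingartenValue m W ↔ W = WgA m) ∧
    (∀ (k : ℕ) (m : PairPartition (k + 1)),
      WgA m =
        -(1 / varN) * ∑ i : Fin (2 * k), WgA (Equiv.swap (incl k i) (penult k) • m)
        + varM / varN * (if h : {penult k, ult k} ∈ m.pairs then WgA (m.down h) else 0)
        + 1 / varN * ∑ i : Fin (2 * k),
            (if h : {incl k i, ult k} ∈ m.pairs then
              WgA ((Equiv.swap (incl k i) (penult k) • m).down (last_pair_mem_swap_smul h))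
            else 0)) := by
  refine ⟨fun k m W => ⟨fun h => eq_of_isWeingartenValue h (isWeingartenValue_wgA m), ?_⟩,
    wgA_relation⟩
  rintro rfl
  exact isWeingartenValue_wgA m
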